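/- Work in ZFC together with the generalized continuum hypothesis ($2^{\kappa}=\kappa^{+}$ for every infinite cardinal $\kappa$) and the assumption that there are no inaccessible cardinals. Transition algebra ($\mathsf{TA}$) is the following logic. A signature $\Sigma=(S,F,L)$ consists of a set $S$ of sorts, a set $F$ of function symbols $\sigma:w\to s$ with $w\in S^{*}$, $s\in S$, and a set $L$ of transition labels. A $\Sigma$-model $\mathfrak{A}$ consists of a (possibly empty) set $\mathfrak{A}_s$ for each sort $s$, a function $\sigma^{\mathfrak{A}}:\mathfrak{A}_{s_1}\times\dots\times\mathfrak{A}_{s_n}\to\mathfrak{A}_s$ for each $\sigma:s_1\dots s_n\to s$ in $F$, and a relation $\varrho^{\mathfrak{A}}_s\subseteq\mathfrak{A}_s\times\mathfrak{A}_s$ for each $\varrho\in L$ and $s\in S$; homomorphisms preserve operations and transition relations, and isomorphisms are invertible homomorphisms. Actions are generated from labels by composition $\mathfrak{a}_1;\mathfrak{a}_2$, union $\mathfrak{a}_1\cup\mathfrak{a}_2$ and iteration $\mathfrak{a}^{*}$, interpreted in each model as composition, union and reflexive-transitive closure of relations. Sentences over $\Sigma$ are given by $\phi ::= t=t' \mid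 \mathfrak{a}(t_1,t_2)\mid\neg\phi\mid\bigvee\Phi\mid\exists X\,\phi'$, where $t,t'$ and $t_1,t_2$ are pairs of ground $\Sigma$-terms of the same sort, $\mathfrak{a}$ is an action, $\Phi$ is a finite set of $\Sigma$-sentences, $X$ is a finite set of sorted variables and $\phi'$ is a sentence over $\Sigma[X]$, the signature $\Sigma$ with the elements of $X$ added as new constants; satisfaction is the usual one ($\mathfrak{A}\models\exists X\,\phi'$ iff some expansion of $\mathfrak{A}$ to $\Sigma[X]$ satisfies $\phi'$). A model is reachable if each of its elements is the value of a ground term. Theorem 1 (Categoricity). Let $\mathfrak{A}$ be a model over a signature $\Sigma=(S,F,L)$. Then there exist a signature $\Sigma^{\circ}=(S,F^{\circ},L^{\circ})$ with the same sorts, with $F\subseteq F^{\circ}$, $L\subseteq L^{\circ}$ and $L^{\circ}\setminus L$ consisting of exactly two labels, and a reachable $\Sigma^{\circ}$-model $\mathfrak{A}^{\circ}$ whose reduct to $\Sigma$ is $\mathfrak{A}$, such that every $\Sigma^{\circ}$-model that satisfies the full theory $Th(\mathfrak{A}^{\circ})=\{\phi\in\mathsf{Sen}(\Sigma^{\circ})\mid\mathfrak{A}^{\circ}\models\phi\}$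 is isomorphic to $\mathfrak{A}^{\circ}$. -/

import Mathlib

namespace TA

/-- A signature `(S, F, L)` with set of sorts `S`: `F w s` is the set of function symbols
`σ : w → s`, and `L` is the set of transition labels. -/
structure Signature (S : Type) : Type 1 where
  /-- function symbols of a given arity and sort -/
  F : List S → S → Type
  /-- transition labels -/
  L : Type

variable {S : Type}

/-- A signature morphism that is the identity on sorts. -/
structure SigMor (Sg Sg' : Signature S) where
  op : ∀ {w : List S} {s : S}, Sg.F w s → Sg'.F w s
  lb : Sg.L → Sg'.L

/-- A sort preserving inclusion of signatures: distinct symbols stay distinct. -/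
structure SigMor.IsInclusion {Sg Sg' : Signature S} (χ : SigMor Sg Sg') : Prop where
  op_injective : ∀ (w : List S) (s : S), Function.Injective (χ.op : Sg.F w s → Sg'.F w s)
  lb_injective : Function.Injective χ.lb

/-- A transition algebra: carrier sets (possibly empty), operations, and for every label a
many-sorted transition relation. -/
structure Model (Sg : Signature S) : Type 1 where
  carrier : S → Type
  op : ∀ {w : List S} {s : S}, Sg.F w s →
    (∀ i : Fin w.length, carrier (w.get i)) → carrier s
  rel : Sg.L → ∀ s : S, carrier s → carrier s → Prop

/-- The reduct of a model along a signature morphism. -/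
def Model.reduct {Sg Sg' : Signature S} (A : Model Sg') (χ : SigMor Sg Sg') : Model Sg where
  carrier := A.carrier
  op σ := A.op (χ.op σ)
  rel ρ := A.rel (χ.lb ρ)

/-- `A'` is a `χ`-expansion of `A`. -/
def IsExpansion {Sg Sg' : Signature S} (χ : SigMor Sg Sg') (A : Model Sg) (A' : Model Sg') :
    Prop :=
  A'.reduct χ = A

/-- Homomorphisms of transition algebras. -/
structure Hom {Sg : Signature S} (A B : Model Sg) where
  map : ∀ s : S, A.carrier s → B.carrier s
  map_op : ∀ {w : List S} {s : S} (σ : Sg.F w s) (a : ∀ i : Fin w.length, A.carrier (w.get i)),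
    map s (A.op σ a) = B.op σ (fun i => map (w.get i) (a i))
  map_rel : ∀ (ρ : Sg.L) (s : S) (a b : A.carrier s),
    A.rel ρ s a b → B.rel ρ s (map s a) (map s b)

/-- Isomorphism of models: homomorphisms in both directions that are mutually inverse. -/
def Isomorphic {Sg : Signature S} (A B : Model Sg) : Prop :=
  ∃ (h : Hom A B) (g : Hom B A),
    (∀ s a, g.map s (h.map s a) = a) ∧ (∀ s b, h.map s (g.map s b) = b)

/-- Ground terms over a signature. -/
inductive Term (Sg : Signature S) : S → Type
  | app {w : List S} {s : S} (σ : Sg.F w s)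
      (args : ∀ i : Fin w.length, Term Sg (w.get i)) : Term Sg s

/-- The interpretation of ground terms in a model. -/
def Term.eval {Sg : Signature S} (A : Model Sg) : ∀ {s : S}, Term Sg s → A.carrier s
  | _, .app σ args => A.op σ (fun i => (args i).eval A)

/-- The initial model `T_Σ` of ground terms, all of whose transition relations are empty. -/
def termModel (Sg : Signature S) : Model Sg where
  carrier := Term Sg
  op σ args := .app σ args
  rel _ _ _ _ := False

/-- The homomorphism `T_Σ → A` given by the interpretation of terms. -/
def evalHom {Sg : Signature S} (A : Model Sg) : Hom (termModel Sg) A where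
  map _ t := Term.eval A t
  map_op _ _ := rfl
  map_rel _ _ _ _ h := h.elim

/-- `evalHom A` is the only homomorphism `T_Σ → A`. -/
theorem evalHom_unique {Sg : Signature S} {A : Model Sg} (h : Hom (termModel Sg) A) (s : S)
    (t : Term Sg s) : h.map s t = (evalHom A).map s t := by
  induction t with
  | app σ args ih =>
    refine (h.map_op σ args).trans ?_
    exact congrArg (A.op σ) (funext ih)

/-- A model is reachable if the unique homomorphism `T_Σ → A` is surjective. -/
def Model.Reachable {Sg : Signature S} (A : Model Sg) : Prop :=
  ∀ s : S, Function.Surjective ((evalHom A).map s)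

/-- Actions over a set of labels. -/
inductive Action (L : Type) : Type
  | label (ρ : L) : Action L
  | comp (a b : Action L) : Action L
  | union (a b : Action L) : Action L
  | star (a : Action L) : Action L

/-- The interpretation of actions as many-sorted binary relations. -/
def Action.interp {Sg : Signature S} (A : Model Sg) (s : S) :
    Action Sg.L → A.carrier s → A.carrier s → Prop
  | .label ρ => A.rel ρ s
  | .comp a b => Relation.Comp (a.interp A s) (b.interp A s)
  | .union a b => fun x y => a.interp A s x y ∨ b.interp A s x y
  | .star a => Relation.ReflTransGen (a.interp A s)

/-- Function symbols of `Σ[C]`: those of `Σ`, and the elements of the `S`-sorted set `C` as new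
constants. -/
inductive ExtF (Sg : Signature S) (C : S → Type) : List S → S → Type
  | old {w : List S} {s : S} (σ : Sg.F w s) : ExtF Sg C w s
  | new {s : S} (c : C s) : ExtF Sg C [] s

/-- The signature `Σ[C]`. -/
def Signature.ext (Sg : Signature S) (C : S → Type) : Signature S where
  F := ExtF Sg C
  L := Sg.L

/-- The expansion of a model to `Σ[C]` determined by a valuation of `C`; every expansion of `A`
along `Σ ↪ Σ[C]` is of this form. -/
def Model.expand {Sg : Signature S} (A : Model Sg) {C : S → Type}
    (f : ∀ s : S, C s → A.carrier s) : Model (Sg.ext C) where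
  carrier := A.carrier
  op
    | .old σ, args => A.op σ args
    | .new c, _ => f _ c
  rel := A.rel

/-- A finite block of variables: a finite set of pairs of a variable name and a sort, in which
variables of distinct sorts have distinct names. -/
structure Block (S : Type) where
  vars : Finset (ℕ × S)
  names_ne : ∀ x ∈ vars, ∀ y ∈ vars, x.2 ≠ y.2 → x.1 ≠ y.1

/-- The `S`-sorted set underlying a block of variables. -/
def Block.toSorted (X : Block S) (s : S) : Type := {i : ℕ // (i, s) ∈ X.vars}

/-- Sentences of transition algebra. The body of `∃X` is a sentence over `Σ[X]`. A finite set of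
disjuncts is presented by a finite (possibly empty) enumeration. -/
inductive Sentence : Signature S → Type 1
  | eq {Sg : Signature S} {s : S} (t t' : Term Sg s) : Sentence Sg
  | trans {Sg : Signature S} (a : Action Sg.L) {s : S} (t t' : Term Sg s) : Sentence Sg
  | neg {Sg : Signature S} (φ : Sentence Sg) : Sentence Sg
  | disj {Sg : Signature S} (n : ℕ) (Φ : Fin n → Sentence Sg) : Sentence Sg
  | ex {Sg : Signature S} (X : Block S) (φ : Sentence (Sg.ext X.toSorted)) : Sentence Sg

/-- The satisfaction relation. -/
def Sat : ∀ {Sg : Signature S}, Model Sg → Sentence Sg → Prop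
  | _, A, .eq t t' => t.eval A = t'.eval A
  | _, A, .trans (s := s) a t t' => a.interp A s (t.eval A) (t'.eval A)
  | _, A, .neg φ => ¬ Sat A φ
  | _, A, .disj _ Φ => ∃ i, Sat A (Φ i)
  | _, A, .ex X φ => ∃ f : ∀ s : S, X.toSorted s → A.carrier s, Sat (A.expand f) φ

/-- The full theory of a model. -/
def Th {Sg : Signature S} (A : Model Sg) : Set (Sentence Sg) := {φ | Sat A φ}

/-- `A` is a model of the presentation `(Σ, Φ)`. -/
def IsModelOf {Sg : Signature S} (A : Model Sg) (Φ : Set (Sentence Sg)) : Prop :=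
  ∀ φ ∈ Φ, Sat A φ

/-- The generalized continuum hypothesis for the universe of sets `Type`. -/
def GCH : Prop := ∀ κ : Cardinal.{0}, Cardinal.aleph0 ≤ κ → Order.succ κ = 2 ^ κ

/-- There are no inaccessible cardinals in the universe of sets `Type`. (In a higher universe
this would be refutable, since the cardinality of `Type` is inaccessible there.) -/
def NoInaccessible : Prop := ¬ ∃ κ : Cardinal.{0}, κ.IsInaccessible

end TA

open Cardinal

namespace TA

/-! ### Decomposing self-maps of a set according to the cardinality of their range. -/

section Combinatorics

variable {α : Type}

/-! Expand `A` by symbols for all operations on its carriers, constants included, and by a label for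
the graph of a map `succ` with an infinite orbit in each infinite sort. If every element of a model
`B` of the theory is named by a constant, then `a ↦ name B a` is an isomorphism. So it suffices that
every unary operation `f` is `Pinned`, that is, takes only named values in `B`; the case `f = id`
finishes.

This goes by induction on the cardinality of the range of `f` in `A`. A finite range is listed by a
disjunction. A countable one factors through an orbit of `succ`, which iteration of the label keeps
standard (`pinned_of_countable`). A singular one is pasted from maps with smaller ranges
(`pinned_of_isSingular`). At a successor `μ⁺`, an unnamed value would code all `μ⁺` named values by
`μ` parameters (`pinned_of_succ`). Under GCH a further case would be an inaccessible cardinal. -/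

theorem exists_injective_iterate (α : Type) [Infinite α] :
    ∃ (σ : α → α) (a : α), Function.Injective fun n : ℕ => σ^[n] a := by
  let e := Infinite.natEmbedding α
  -- The shift on an embedded copy of ℕ, the identity elsewhere.
  refine ⟨Function.extend e (fun n => e (n + 1)) id, e 0, ?_⟩
  have h : ∀ n : ℕ, (Function.extend e (fun n => e (n + 1)) id)^[n] (e 0) = e n := by
    intro n
    induction n with
    | zero => rfl
    | succ n ih => rw [Function.iterate_succ_apply', ih, e.injective.extend_apply]
  intro m n hmn
  exact e.injective (by simpa only [h] using hmn)

/-- A function with countable range factors through any infinite orbit. -/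
theorem exists_factor_orbit {f : α → α} (hf : (Set.range f).Countable) {σ : α → α} {a : α}
    (hσ : Function.Injective fun n : ℕ => σ^[n] a) :
    ∃ k m : α → α, (∀ x, k (m x) = f x) ∧ ∀ x, ∃ n : ℕ, m x = σ^[n] a := by
  have : Nonempty α := ⟨a⟩
  obtain ⟨u, hu⟩ := hf.exists_eq_range (Set.range_nonempty f)
  have hx : ∀ x, ∃ n, u n = f x := fun x => by
    have : f x ∈ Set.range u := hu ▸ Set.mem_range_self x
    exact this
  choose n hn using hx
  -- `m` encodes `f x` by an index in the enumeration `u`, stored as an orbit point; `k` decodes it.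
  exact ⟨Function.extend (fun n : ℕ => σ^[n] a) u id, fun x => σ^[n x] a,
    fun x => by rw [hσ.extend_apply u id (n x), hn], fun x => ⟨n x, rfl⟩⟩

/-- A function with range of singular cardinality is pasted from functions with smaller
ranges, which are indexed by the values of a function with smaller range. -/
theorem exists_paste_of_isSingular {f : α → α} (hf : (#(Set.range f)).IsSingular) :
    ∃ (p : α → α) (k : α → α → α), #(Set.range p) < #(Set.range f) ∧
      (∀ i, #(Set.range (k i)) < #(Set.range f)) ∧ ∀ x, f x = k (p x) (f x) := by
  classical
  -- The order type is an initial ordinal, so every `Set.Iic` is smaller than the whole range.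
  obtain ⟨_, _, ho⟩ := exists_ord_eq_type_lt (Set.range f)
  have hinf : ℵ₀ ≤ #(Set.range f) := hf.aleph0_le
  obtain ⟨T, hT, hTc⟩ := Order.exists_cof_eq (Set.range f)
  have hcof : Order.cof (Set.range f) < #(Set.range f) := by
    have := hf.cof_ord_lt
    rwa [ho, Ordinal.cof_type] at this
  choose q hqT hq using hT
  obtain ⟨u⟩ : Nonempty (Set.range f) := mk_ne_zero_iff.1 (aleph0_pos.trans_le hinf).ne'
  -- `p x` is a bound of `f x` in a cofinal set of minimal size; `k i` fixes the values up to `i`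
  -- and sends everything else to `u`.
  refine ⟨fun x => q ⟨f x, x, rfl⟩, fun i z =>
    if ∃ (hi : i ∈ Set.range f) (hz : z ∈ Set.range f), (⟨z, hz⟩ : Set.range f) ≤ ⟨i, hi⟩
      then z else u, ?_, ?_, ?_⟩
  · refine lt_of_le_of_lt ?_ (hTc ▸ hcof)
    refine (mk_le_mk_of_subset (t := Subtype.val '' T) ?_).trans mk_image_le
    rintro _ ⟨x, rfl⟩
    exact ⟨_, hqT _, rfl⟩
  · intro i
    by_cases hi : i ∈ Set.range f
    · have hlt := mk_Iic_lt (⟨i, hi⟩ : Set.range f) ho hinf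
      refine lt_of_le_of_lt ((mk_le_mk_of_subset
        (t := insert (u : α) (Subtype.val '' Set.Iic (⟨i, hi⟩ : Set.range f))) ?_).trans
          ((mk_insert_le).trans (add_le_add_left mk_image_le _))) (add_lt_of_lt hinf hlt
            (one_lt_aleph0.trans_le hinf))
      rintro _ ⟨z, rfl⟩
      dsimp only
      split_ifs with h
      · obtain ⟨_, hz, hle⟩ := h
        exact Or.inr ⟨⟨z, hz⟩, hle, rfl⟩
      · exact Or.inl rfl
    · refine lt_of_le_of_lt ((mk_le_mk_of_subset (t := {(u : α)}) ?_).trans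
        (mk_singleton _).le) (one_lt_aleph0.trans_le hinf)
      rintro _ ⟨z, rfl⟩
      exact if_neg fun h => hi h.1
  · intro x
    exact (if_pos ⟨(q ⟨f x, x, rfl⟩).2, ⟨x, rfl⟩, hq _⟩).symm

/-- For a function `f` with range of successor cardinality `μ⁺`, of any two values of `f` one is
obtained from the other and a parameter that ranges over a set of cardinality `μ`. -/
theorem exists_compare_of_succ {f : α → α} {μ : Cardinal.{0}} (hμ : ℵ₀ ≤ μ)
    (hf : #(Set.range f) = Order.succ μ) :
    ∃ (g : α → α) (h p : α → α → α), #(Set.range g) = μ ∧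
      ∀ x y, f y = h (f x) (g (p x y)) ∨ f x = h (f y) (g (p x y)) := by
  classical
  obtain ⟨_, _, ho⟩ := exists_ord_eq_type_lt (Set.range f)
  have hinf : ℵ₀ ≤ #(Set.range f) := hf ▸ hμ.trans (Order.le_succ μ)
  obtain ⟨T, hT⟩ := le_mk_iff_exists_set.1 ((Order.le_succ μ).trans hf.ge)
  have hj : ∀ u : Set.range f, Nonempty (Set.Iic u ↪ T) := fun u => by
    refine (hT ▸ Order.lt_succ_iff.1 (hf ▸ mk_Iic_lt u ho hinf) : #(Set.Iic u) ≤ #T)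
  let j := fun u => (hj u).some
  -- `h u` decodes: it inverts the injection `j u` of the initial segment below `u` into the fixed
  -- set `T` of size `μ`.
  let h : α → α → α := fun u z =>
    if hu : u ∈ Set.range f then
      Function.extend (fun w : Set.Iic (⟨u, hu⟩ : Set.range f) => ((j _ w : Set.range f) : α))
        (fun w => ((w : Set.range f) : α)) id z
    else z
  have hh : ∀ u v : Set.range f, v ≤ u → ∃ t : T, (v : α) = h u (t : Set.range f) := by
    intro u v hvu
    refine ⟨j u ⟨v, hvu⟩, ?_⟩
    have hinj : Function.Injective
        (fun w : Set.Iic u => ((j u w : Set.range f) : α)) :=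
      Subtype.val_injective.comp (Subtype.val_injective.comp (j u).injective)
    simp only [h, dif_pos u.2]
    exact (hinj.extend_apply (fun w => ((w : Set.range f) : α)) id ⟨v, hvu⟩).symm
  obtain ⟨t₀⟩ : Nonempty T := mk_ne_zero_iff.1 (hT ▸ (aleph0_pos.trans_le hμ).ne')
  -- A retraction onto `T`, so that the parameters are exactly the values of an operation.
  let g : α → α := fun z => if z ∈ Subtype.val '' T then z else (t₀ : Set.range f)
  have hg : ∀ t : T, g (t : Set.range f) = (t : Set.range f) := fun t => if_pos ⟨_, t.2, rfl⟩
  have hrange : Set.range g = Subtype.val '' T := by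
    ext z
    constructor
    · rintro ⟨y, rfl⟩
      by_cases hy : y ∈ Subtype.val '' T
      · simp only [g, if_pos hy, hy]
      · simp only [g, if_neg hy]
        exact ⟨_, t₀.2, rfl⟩
    · rintro ⟨t, ht, rfl⟩
      exact ⟨t, hg ⟨t, ht⟩⟩
  have hp : ∀ x y, ∃ z, f y = h (f x) (g z) ∨ f x = h (f y) (g z) := by
    intro x y
    rcases le_total (⟨f y, y, rfl⟩ : Set.range f) ⟨f x, x, rfl⟩ with hle | hle
    · obtain ⟨t, ht⟩ := hh _ _ hle
      exact ⟨(t : Set.range f), Or.inl (by rw [hg]; exact ht)⟩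
    · obtain ⟨t, ht⟩ := hh _ _ hle
      exact ⟨(t : Set.range f), Or.inr (by rw [hg]; exact ht)⟩
  choose p hp using hp
  exact ⟨g, h, p, by rw [hrange, mk_image_eq Subtype.val_injective, hT], hp⟩

/-- Under GCH and in the absence of inaccessible cardinals, every uncountable cardinal is singular
or a successor. -/
theorem isSingular_or_eq_succ (hGCH : GCH) (hNIC : NoInaccessible) {κ : Cardinal.{0}}
    (hκ : ℵ₀ < κ) : κ.IsSingular ∨ ∃ μ, ℵ₀ ≤ μ ∧ κ = Order.succ μ := by
  rcases isRegular_or_isSingular hκ.le with hr | hs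
  · right
    by_contra! hsucc
    -- A regular `κ` that is not a successor is a strong limit, since `2 ^ μ` is the successor of
    -- `μ` for infinite `μ`.
    refine hNIC ⟨κ, hκ, hr.cof_ord.ge, fun μ hμ => ?_⟩
    rcases lt_or_ge μ ℵ₀ with h | h
    · exact (power_lt_aleph0 (natCast_lt_aleph0 (n := 2)) h).trans hκ
    · rw [← hGCH μ h]
      exact lt_of_le_of_ne (Order.succ_le_of_lt hμ) (hsucc μ h).symm
  · exact Or.inl hs

end Combinatorics

variable {S : Type}

/-! ### Argument tuples and evaluation for arities up to two. -/

section Terms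

variable {P : S → Type} {s : S}

/-- The argument tuple of a constant. -/
def args₀ : ∀ i : Fin ([] : List S).length, P (([] : List S).get i) := fun i => i.elim0

/-- The argument tuple of a unary operation on `s`. -/
def args₁ (x : P s) : ∀ i : Fin [s].length, P ([s].get i)
  | ⟨0, _⟩ => x

/-- The argument tuple of a binary operation on `s`. -/
def args₂ (x y : P s) : ∀ i : Fin [s, s].length, P ([s, s].get i)
  | ⟨0, _⟩ => x
  | ⟨1, _⟩ => y

theorem eval_args₀ {Sg : Signature S} (M : Model Sg) (F : Sg.F [] s) :
    (Term.app F args₀).eval M = M.op F args₀ :=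
  congrArg (M.op F) (funext fun i => i.elim0)

theorem eval_args₁ {Sg : Signature S} (M : Model Sg) (F : Sg.F [s] s) (t : Term Sg s) :
    (Term.app F (args₁ t)).eval M = M.op F (args₁ (t.eval M)) :=
  congrArg (M.op F) (funext fun | ⟨0, _⟩ => rfl)

theorem eval_args₂ {Sg : Signature S} (M : Model Sg) (F : Sg.F [s, s] s) (t t' : Term Sg s) :
    (Term.app F (args₂ t t')).eval M = M.op F (args₂ (t.eval M) (t'.eval M)) :=
  congrArg (M.op F) (funext fun | ⟨0, _⟩ => rfl | ⟨1, _⟩ => rfl)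

end Terms

/-- A block of two variables of sort `s`. -/
def Block.pair (s : S) : Block S where
  vars := {0, 1} ×ˢ {s}
  names_ne x hx y hy h := by
    rw [Finset.mem_product, Finset.mem_singleton] at hx hy
    exact absurd (hx.2.trans hy.2.symm) h

theorem Block.pair_mem (s : S) (i : Fin 2) : ((i : ℕ), s) ∈ (Block.pair s).vars := by
  fin_cases i <;> simp [Block.pair]

/-- The valuation of `Block.pair s` given by two elements. -/
def Block.pairVal {P : S → Type} {s : S} (x y : P s) (s' : S)
    (v : (Block.pair s).toSorted s') : P s' :=
  (show s = s' from (Finset.mem_singleton.1 (Finset.mem_product.1 v.2).2).symm) ▸ (if v.1 = 0 then x else y)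

/-! ### Transfer of sentences from a model to the models of its theory. -/

section Transfer

variable {Sg : Signature S} {A B : Model Sg}

/-- A model of the theory of `A` satisfies only sentences that hold in `A`. -/
theorem sat_iff_of_isModelOf (hB : IsModelOf B (Th A)) (φ : Sentence Sg) : Sat B φ ↔ Sat A φ :=
  ⟨fun h => by_contra fun hn => hB (.neg φ) hn h, hB φ⟩

/-- Validity over all values of two variables transfers to models of the theory. -/
theorem sat_pair_transfer (hB : IsModelOf B (Th A)) (s : S)
    (φ : Sentence (Sg.ext (Block.pair s).toSorted))
    (hA : ∀ v, Sat (A.expand v) φ) (x y : B.carrier s) :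
    Sat (B.expand (Block.pairVal x y)) φ := by
  have h : Sat B (.neg (.ex (Block.pair s) (.neg φ))) :=
    hB _ fun ⟨v, hv⟩ => hv (hA v)
  by_contra hn
  exact h ⟨_, hn⟩

variable {s : S}

/-- A variable of the block `Block.pair s` as a term. -/
def var (i : Fin 2) : Term (Sg.ext (Block.pair s).toSorted) s :=
  .app (ExtF.new (⟨i, Block.pair_mem s i⟩ : (Block.pair s).toSorted s)) args₀

theorem eval_var_zero (M : Model Sg) (x y : M.carrier s) :
    (var 0).eval (M.expand (Block.pairVal x y)) = x := rfl

theorem eval_var_one (M : Model Sg) (x y : M.carrier s) :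
    (var 1).eval (M.expand (Block.pairVal x y)) = y := rfl

end Transfer

/-! ### The full expansion and the named elements of its models. -/

section FullExpansion

variable {Sg : Signature S}

/-- Two new labels, and as new function symbols all operations on the carriers of `A`. -/
def Signature.full (A : Model Sg) : Signature S where
  F w s := Sg.F w s ⊕ ((∀ i : Fin w.length, A.carrier (w.get i)) → A.carrier s)
  L := Sg.L ⊕ Bool

/-- The inclusion of the signature of `A` into `Signature.full A`. -/
def fullInclusion (A : Model Sg) : SigMor Sg (Signature.full A) where
  op := Sum.inl
  lb := Sum.inl

theorem fullInclusion_isInclusion (A : Model Sg) : (fullInclusion A).IsInclusion where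
  op_injective _ _ := Sum.inl_injective
  lb_injective := Sum.inl_injective

theorem ncard_compl_range_lb (A : Model Sg) : (Set.range (fullInclusion A).lb)ᶜ.ncard = 2 := by
  have : (Set.range (fullInclusion A).lb)ᶜ = Set.range (Sum.inr : Bool → Sg.L ⊕ Bool) :=
    Set.compl_range_inl
  rw [this]
  refine (congrArg Set.ncard Set.image_univ.symm).trans
    ((Set.ncard_image_of_injective _ Sum.inr_injective).trans ?_)
  rw [Set.ncard_univ, Nat.card_eq_fintype_card, Fintype.card_bool]

/-- The expansion of `A` to `Signature.full A` that interprets every operation as itself, one of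
the new labels by the graph of `succ`, and the other one by equality. Iteration of the first label
is what pins countable sets; the uncountable ones are pinned by the operations alone. -/
def Model.full (A : Model Sg) (succ : ∀ s, A.carrier s → A.carrier s) :
    Model (Signature.full A) where
  carrier := A.carrier
  op
    | .inl σ, a => A.op σ a
    | .inr f, a => f a
  rel
    | .inl ρ => A.rel ρ
    | .inr true => fun s x y => y = succ s x
    | .inr false => fun _ x y => y = x

theorem full_isExpansion (A : Model Sg) (succ : ∀ s, A.carrier s → A.carrier s) :
    IsExpansion (fullInclusion A) A (A.full succ) := rfl

/-- The constant symbol that names an element. -/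
def nameSym {A : Model Sg} {s : S} (a : A.carrier s) : (Signature.full A).F [] s :=
  .inr fun _ => a

theorem full_reachable (A : Model Sg) (succ : ∀ s, A.carrier s → A.carrier s) :
    (A.full succ).Reachable :=
  fun _ a => ⟨.app (nameSym a) args₀, rfl⟩

/-- The symbol of a unary operation. -/
def unarySym {A : Model Sg} {s : S} (f : A.carrier s → A.carrier s) :
    (Signature.full A).F [s] s :=
  .inr fun a => f (a ⟨0, Nat.one_pos⟩)

/-- The symbol of a binary operation. -/
def binarySym {A : Model Sg} {s : S} (f : A.carrier s → A.carrier s → A.carrier s) :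
    (Signature.full A).F [s, s] s :=
  .inr fun a => f (a ⟨0, Nat.two_pos⟩) (a ⟨1, Nat.one_lt_two⟩)

variable {A : Model Sg} {succ : ∀ s, A.carrier s → A.carrier s} {B : Model (Signature.full A)}

/-- The value in `B` of the name of an element of `A`. -/
def name (B : Model (Signature.full A)) {s : S} (a : A.carrier s) : B.carrier s :=
  B.op (nameSym a) args₀

/-- The interpretation in `B` of a unary operation of `A`. -/
def unary (B : Model (Signature.full A)) {s : S} (f : A.carrier s → A.carrier s)
    (x : B.carrier s) : B.carrier s :=
  B.op (unarySym f) (args₁ x)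

/-- The interpretation in `B` of a binary operation of `A`. -/
def binary (B : Model (Signature.full A)) {s : S} (f : A.carrier s → A.carrier s → A.carrier s)
    (x y : B.carrier s) : B.carrier s :=
  B.op (binarySym f) (args₂ x y)

theorem name_inj (hB : IsModelOf B (Th (A.full succ))) {s : S} {a b : A.carrier s} :
    name B a = name B b ↔ a = b := by
  have := sat_iff_of_isModelOf hB (.eq (.app (nameSym a) args₀) (.app (nameSym b) args₀))
  simp only [Sat, eval_args₀] at this
  exact this

theorem op_name (hB : IsModelOf B (Th (A.full succ))) {w : List S} {s : S}
    (σ : (Signature.full A).F w s) (a : ∀ i : Fin w.length, A.carrier (w.get i)) :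
    B.op σ (fun i => name B (a i)) = name B ((A.full succ).op σ a) := by
  have := hB (.eq (.app σ fun i => .app (nameSym (a i)) args₀)
    (.app (nameSym ((A.full succ).op σ a)) args₀)) rfl
  rw [Sat, eval_args₀, Term.eval] at this
  simpa only [eval_args₀, name] using this

theorem rel_name (hB : IsModelOf B (Th (A.full succ))) (ρ : (Signature.full A).L) {s : S}
    (a b : A.carrier s) :
    B.rel ρ s (name B a) (name B b) ↔ (A.full succ).rel ρ s a b := by
  have := sat_iff_of_isModelOf hB
    (.trans (.label ρ) (.app (nameSym a) args₀) (.app (nameSym b) args₀))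
  simp only [Sat, eval_args₀, Action.interp] at this
  exact this

theorem unary_name (hB : IsModelOf B (Th (A.full succ))) {s : S} (f : A.carrier s → A.carrier s)
    (a : A.carrier s) : unary B f (name B a) = name B (f a) := by
  refine Eq.trans ?_ (op_name hB (unarySym f) (args₁ a))
  exact congrArg (B.op (unarySym f)) (funext fun | ⟨0, _⟩ => rfl)

theorem binary_name (hB : IsModelOf B (Th (A.full succ))) {s : S}
    (f : A.carrier s → A.carrier s → A.carrier s) (a b : A.carrier s) :
    binary B f (name B a) (name B b) = name B (f a b) := by
  refine Eq.trans ?_ (op_name hB (binarySym f) (args₂ a b))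
  exact congrArg (B.op (binarySym f)) (funext fun | ⟨0, _⟩ => rfl | ⟨1, _⟩ => rfl)

/-- A model of the theory of the full expansion in which all elements are named is isomorphic to
it. -/
theorem isomorphic_of_name_surjective (hB : IsModelOf B (Th (A.full succ)))
    (h : ∀ s (b : B.carrier s), ∃ a : A.carrier s, b = name B a) :
    Isomorphic B (A.full succ) := by
  choose r hr using h
  have hrn : ∀ s (a : A.carrier s), r s (name B a) = a := fun s a =>
    ((name_inj hB).1 (hr s (name B a))).symm
  refine ⟨⟨r, fun {w s} σ b => ?_, fun ρ s b b' hbb => ?_⟩,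
    ⟨fun s a => name B a, fun σ a => (op_name hB σ a).symm,
      fun ρ s a b => (rel_name hB ρ a b).2⟩, fun s b => (hr s b).symm, hrn⟩
  · refine (name_inj hB).1 ?_
    rw [← hr, ← op_name hB]
    exact congrArg (B.op σ) (funext fun i => hr _ (b i))
  · rw [hr s b, hr s b'] at hbb
    exact (rel_name hB ρ _ _).1 hbb

end FullExpansion

variable {Sg : Signature S} {A : Model Sg}

/-! ### Terms in two variables over the full signature. -/

section QuantifierFree

variable {s : S}

/-- The application of a unary operation in the extension by two variables. -/
def app₁ (f : A.carrier s → A.carrier s)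
    (t : Term ((Signature.full A).ext (Block.pair s).toSorted) s) :
    Term ((Signature.full A).ext (Block.pair s).toSorted) s :=
  .app (ExtF.old (unarySym f)) (args₁ t)

/-- The application of a binary operation in the extension by two variables. -/
def app₂ (f : A.carrier s → A.carrier s → A.carrier s)
    (t t' : Term ((Signature.full A).ext (Block.pair s).toSorted) s) :
    Term ((Signature.full A).ext (Block.pair s).toSorted) s :=
  .app (ExtF.old (binarySym f)) (args₂ t t')

/-- A name in the extension by two variables. -/
def app₀ (a : A.carrier s) : Term ((Signature.full A).ext (Block.pair s).toSorted) s :=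
  .app (ExtF.old (nameSym a)) args₀

variable {B : Model (Signature.full A)}
  (v : ∀ s', (Block.pair s).toSorted s' → B.carrier s')
  (t t' : Term ((Signature.full A).ext (Block.pair s).toSorted) s)

theorem eval_app₀ (a : A.carrier s) : (app₀ a).eval (B.expand v) = name B a :=
  eval_args₀ _ _

theorem eval_app₁ (f : A.carrier s → A.carrier s) :
    (app₁ f t).eval (B.expand v) = unary B f (t.eval (B.expand v)) :=
  eval_args₁ _ _ _

theorem eval_app₂ (f : A.carrier s → A.carrier s → A.carrier s) :
    (app₂ f t t').eval (B.expand v) =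
      binary B f (t.eval (B.expand v)) (t'.eval (B.expand v)) :=
  eval_args₂ _ _ _ _

end QuantifierFree

/-! ### Pinning all operations by induction on the size of the range. -/

section Pinning

variable {succ : ∀ s, A.carrier s → A.carrier s} {B : Model (Signature.full A)} {s : S}


/-- All values in `B` of the operation `f` are named. -/
def Pinned (B : Model (Signature.full A)) (f : A.carrier s → A.carrier s) : Prop :=
  ∀ x : B.carrier s, ∃ a, unary B f x = name B a

/-- The values of a pinned operation are named by values of this operation. -/
theorem Pinned.exists_eq_name_apply (hB : IsModelOf B (Th (A.full succ)))
    {f : A.carrier s → A.carrier s} (hf : Pinned B f) (x : B.carrier s) :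
    ∃ a, unary B f x = name B (f a) := by
  -- `r` picks preimages under `f`. The identity `f (r (f x)) = f x` transfers to `B`, so a value of
  -- `f` named by `a` is also named by `f (r a)`.
  obtain ⟨r, hr⟩ : ∃ r : A.carrier s → A.carrier s, ∀ x, f (r (f x)) = f x := by
    classical
    refine ⟨fun y => if h : ∃ x, f x = y then h.choose else y, fun x => ?_⟩
    have h : ∃ x', f x' = f x := ⟨x, rfl⟩
    simp only [dif_pos h]
    exact h.choose_spec
  have key := sat_pair_transfer hB s
    (.eq (app₁ f (app₁ r (app₁ f (var 0)))) (app₁ f (var 0))) (fun v => hr _) x x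
  simp only [Sat, eval_app₁, eval_var_zero] at key
  obtain ⟨a, ha⟩ := hf x
  refine ⟨r a, ?_⟩
  rw [← key, ha, unary_name hB, unary_name hB]

theorem pinned_of_finite (hB : IsModelOf B (Th (A.full succ)))
    {f : A.carrier s → A.carrier s} (hf : (Set.range f).Finite) : Pinned B f := by
  intro x
  have := hf.to_subtype
  obtain ⟨n, ⟨e⟩⟩ := Finite.exists_equiv_fin (Set.range f)
  have key := sat_pair_transfer hB s
    (.disj n fun i => .eq (app₁ f (var 0)) (app₀ (e.symm i : A.carrier s)))
    (fun v => by
      let y : Set.range f := ⟨f (v s ⟨0, Block.pair_mem s 0⟩), _, rfl⟩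
      have hy : (y : A.carrier s) = e.symm (e y) := by rw [e.symm_apply_apply]
      exact ⟨e y, hy⟩) x x
  simp only [Sat, eval_app₁, eval_app₀, eval_var_zero] at key
  obtain ⟨i, hi⟩ := key
  exact ⟨_, hi⟩

/-- All elements that are reachable in `B` along the new label from a named element are named. -/
theorem exists_eq_name_of_star (hB : IsModelOf B (Th (A.full succ))) {a : A.carrier s}
    {x : B.carrier s} (h : Relation.ReflTransGen (B.rel (.inr true) s) (name B a) x) :
    ∃ b, x = name B b := by
  induction h with
  | refl => exact ⟨a, rfl⟩
  | @tail y z _ hyz ih =>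
    obtain ⟨b, rfl⟩ := ih
    -- The label stays inside the graph of `succ` in `B`, so each step from a name leads to a name.
    have key := sat_pair_transfer hB s
      (.disj 2 ![.neg (.trans (.label (.inr true)) (var 0) (var 1)),
        .eq (var 1) (app₁ (succ s) (var 0))])
      (fun v => by
        by_cases h : v s ⟨1, Block.pair_mem s 1⟩ = succ s (v s ⟨0, Block.pair_mem s 0⟩)
        · exact ⟨1, h⟩
        · exact ⟨0, h⟩) (name B b) z
    simp only [Sat, Fin.exists_fin_two, Matrix.cons_val_zero, Matrix.cons_val_one, eval_app₁,
      eval_var_zero, eval_var_one, Action.interp] at key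
    rcases key with h | h
    · exact absurd hyz h
    · exact ⟨_, h.trans (unary_name hB _ _)⟩

/-- Iteration has its standard meaning in `B` too: the orbit of a named point acquires no new
elements, and `f` is the image under `k` of a map into that orbit. -/
theorem pinned_of_countable (hB : IsModelOf B (Th (A.full succ))) {a : A.carrier s}
    (ha : Function.Injective fun n : ℕ => (succ s)^[n] a)
    {f : A.carrier s → A.carrier s} (hf : (Set.range f).Countable) : Pinned B f := by
  intro x
  obtain ⟨k, m, hkm, hm⟩ := exists_factor_orbit hf ha
  have star := sat_pair_transfer hB s
    (.trans (.star (.label (.inr true))) (app₀ a) (app₁ m (var 0)))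
    (fun v => by
      obtain ⟨n, hn⟩ := hm (v s ⟨0, Block.pair_mem s 0⟩)
      change Relation.ReflTransGen (fun x y => y = succ s x) a (m _)
      refine hn ▸ ?_
      clear hn
      induction n with
      | zero => exact .refl
      | succ n ih => exact ih.tail (Function.iterate_succ_apply' _ _ _)) x x
  have comp := sat_pair_transfer hB s
    (.eq (app₁ k (app₁ m (var 0))) (app₁ f (var 0))) (fun v => hkm _) x x
  simp only [Sat, eval_app₀, eval_app₁, eval_var_zero] at star comp
  obtain ⟨b, hb⟩ := exists_eq_name_of_star hB star
  exact ⟨k b, by rw [← comp, hb, unary_name hB]⟩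

theorem pinned_of_isSingular (hB : IsModelOf B (Th (A.full succ)))
    {f : A.carrier s → A.carrier s} (hf : (#(Set.range f)).IsSingular)
    (ih : ∀ g : A.carrier s → A.carrier s, #(Set.range g) < #(Set.range f) → Pinned B g) :
    Pinned B f := by
  intro x
  obtain ⟨p, k, hp, hk, hpk⟩ := exists_paste_of_isSingular hf
  have key := sat_pair_transfer hB s
    (.eq (app₁ f (var 0)) (app₂ k (app₁ p (var 0)) (app₁ f (var 0)))) (fun v => hpk _) x x
  simp only [Sat, eval_app₁, eval_app₂, eval_var_zero] at key
  -- Once `p x` is the name of `i`, the binary `k` may be replaced by its slice `k i`, which has a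
  -- smaller range.
  obtain ⟨i, hi⟩ := ih p hp x
  have slice := sat_pair_transfer hB s
    (.eq (app₂ k (app₀ i) (var 0)) (app₁ (k i) (var 0))) (fun v => rfl) (unary B f x) x
  simp only [Sat, eval_app₀, eval_app₁, eval_app₂, eval_var_zero] at slice
  rw [key, hi, slice]
  exact ih (k i) (hk i) _

/-- If `f x` is unnamed in `B`, comparing it with a named value can go only one way, because
decoding `f x` from a name and a named parameter would name it. Hence `f x` decodes every value of
`f` from a parameter in the range of `g`, which is too small. -/
theorem pinned_of_succ (hB : IsModelOf B (Th (A.full succ)))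
    {f : A.carrier s → A.carrier s} {μ : Cardinal.{0}} (hμ : ℵ₀ ≤ μ)
    (hf : #(Set.range f) = Order.succ μ)
    (ih : ∀ g : A.carrier s → A.carrier s, #(Set.range g) = μ → Pinned B g) :
    Pinned B f := by
  obtain ⟨g, h, p, hg, hp⟩ := exists_compare_of_succ hμ hf
  have hgB := ih g hg
  intro x
  by_contra hx
  have himage : ∀ u : Set.range f, ∃ t : Set.range g,
      name B (u : A.carrier s) = binary B h (unary B f x) (name B (t : A.carrier s)) := by
    rintro ⟨_, a, rfl⟩
    have key := sat_pair_transfer hB s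
      (.disj 2 ![.eq (app₁ f (var 1)) (app₂ h (app₁ f (var 0)) (app₁ g (app₂ p (var 0) (var 1)))),
        .eq (app₁ f (var 0)) (app₂ h (app₁ f (var 1)) (app₁ g (app₂ p (var 0) (var 1))))])
      (fun v => by
        rcases hp (v s ⟨0, Block.pair_mem s 0⟩) (v s ⟨1, Block.pair_mem s 1⟩) with h | h
        · exact ⟨0, h⟩
        · exact ⟨1, h⟩) x (name B a)
    simp only [Sat, Fin.exists_fin_two, Matrix.cons_val_zero, Matrix.cons_val_one, eval_app₁,
      eval_app₂, eval_var_zero, eval_var_one, unary_name hB] at key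
    -- The parameter must be named by a value of `g`, not by an arbitrary element: the count is
    -- against `Set.range g`.
    obtain ⟨t, ht⟩ := hgB.exists_eq_name_apply hB (binary B p x (name B a))
    rw [ht] at key
    rcases key with h | h
    · exact ⟨⟨g t, t, rfl⟩, h⟩
    · exact absurd ⟨_, h.trans (binary_name hB _ _ _)⟩ hx
  choose t ht using himage
  have hinj : Function.Injective t := fun u u' huu => by
    refine Subtype.ext ((name_inj hB).1 ?_)
    rw [ht, ht, huu]
  have hle := mk_le_of_injective hinj
  rw [hf, hg] at hle
  exact (Order.lt_succ μ).not_ge hle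

/-- In a model of the theory of the full expansion, all operations on a sort are pinned, by
induction on the cardinality of their ranges. -/
theorem pinned (hGCH : GCH) (hNIC : NoInaccessible) (hB : IsModelOf B (Th (A.full succ)))
    (hsucc : Infinite (A.carrier s) →
      ∃ a : A.carrier s, Function.Injective fun n : ℕ => (succ s)^[n] a)
    (f : A.carrier s → A.carrier s) : Pinned B f := by
  induction hκ : #(Set.range f) using WellFoundedLT.induction generalizing f with
  | ind κ ih =>
  subst hκ
  rcases lt_or_ge ℵ₀ #(Set.range f) with h | h
  · rcases isSingular_or_eq_succ hGCH hNIC h with hs | ⟨μ, hμ, hs⟩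
    · exact pinned_of_isSingular hB hs fun g hg => ih _ hg g rfl
    · exact pinned_of_succ hB hμ hs fun g hg => ih _ (by rw [hg, hs]; exact Order.lt_succ μ) g rfl
  · rcases finite_or_infinite (A.carrier s) with _ | hinf
    · exact pinned_of_finite hB (Set.toFinite _)
    · obtain ⟨a, ha⟩ := hsucc hinf
      exact pinned_of_countable hB ha (le_aleph0_iff_set_countable.1 h)

theorem exists_eq_name (hGCH : GCH) (hNIC : NoInaccessible)
    (hB : IsModelOf B (Th (A.full succ)))
    (hsucc : Infinite (A.carrier s) →
      ∃ a : A.carrier s, Function.Injective fun n : ℕ => (succ s)^[n] a)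
    (x : B.carrier s) : ∃ a : A.carrier s, x = name B a := by
  -- The symbol of `id` denotes the identity of `B`, so pinning its values names all elements.
  have key := sat_pair_transfer hB s (.eq (app₁ id (var 0)) (var 0)) (fun v => rfl) x x
  simp only [Sat, eval_app₁, eval_var_zero] at key
  obtain ⟨a, ha⟩ := pinned hGCH hNIC hB hsucc id x
  exact ⟨a, key.symm.trans ha⟩

end Pinning

end TA

theorem theorem1 (hGCH : TA.GCH) (hNIC : TA.NoInaccessible)
    {S : Type} (Sg : TA.Signature S) (A : TA.Model Sg) :
    ∃ (Sg' : TA.Signature S) (ι : TA.SigMor Sg Sg') (A' : TA.Model Sg'),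
      ι.IsInclusion ∧
      (Set.range ι.lb)ᶜ.ncard = 2 ∧
      TA.IsExpansion ι A A' ∧
      A'.Reachable ∧
      ∀ B : TA.Model Sg', TA.IsModelOf B (TA.Th A') → TA.Isomorphic B A' := by
  have h : ∀ s, ∃ σ : A.carrier s → A.carrier s, Infinite (A.carrier s) →
      ∃ a : A.carrier s, Function.Injective fun n : ℕ => σ^[n] a := by
    intro s
    by_cases hs : Infinite (A.carrier s)
    · obtain ⟨σ, hσ⟩ := TA.exists_injective_iterate (A.carrier s)
      exact ⟨σ, fun _ => hσ⟩
    · exact ⟨id, fun h => absurd h hs⟩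
  choose succ hsucc using h
  exact ⟨_, TA.fullInclusion A, A.full succ, TA.fullInclusion_isInclusion A,
    TA.ncard_compl_range_lb A, TA.full_isExpansion A succ, TA.full_reachable A succ,
    fun B hB => TA.isomorphic_of_name_surjective hB fun s =>
      TA.exists_eq_name hGCH hNIC hB (hsucc s)⟩
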